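/- For $d\ge 1$ let a rational map of degree $d$ be a quotient of two coprime complex polynomials whose larger degree is $d$, regarded as a self-map of the Riemann sphere $\widehat{\mathbb C}=\mathbb C\cup\{\infty\}$. For a rational map $\phi$, let $\mathrm{Aut}(\phi)$ be the group of Möbius transformations $T\in \mathrm{PSL}_2(\mathbb C)$ with $T\circ\phi\circ T^{-1}=\phi$. An antiholomorphic automorphism of $\phi$ is a map $Q=T\circ J$, with $T$ a Möbius transformation and $J(z)=\overline z$, such that $Q\circ\phi\circ Q^{-1}=\phi$. The map $\phi$ is real if $T\circ\phi\circ T^{-1}$ is a rational map with real coefficients for some Möbius transformation $T$, and it is pseudo-real if it admits an antiholomorphic automorphism but is not real. Write $\omega_n=e^{2\pi i/n}$. **Theorem.** Let $n\ge 6$ be an integer, let $r\ge 2$ be an even integer, let $\theta\in\mathbb R$, and let $a_0,\dots,a_r\in\mathbb C$ be such that $$a_1a_r\neq 0,\qquad a_0a_r\neq e^{2i\theta}\,\overline{a_0a_r}.$$ Suppose that the polynomials $$P(z)=\sum_{k=0}^{r}a_kz^k,\qquad Q(z)=\sum_{k=0}^{r}(-1)^k e^{i\theta}\,\overline{a_{r-k}}\,z^k$$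 are coprime, and set $\psi=P/Q$, so that $\psi$ is a rational map of degree $r$. Then $\phi(z)=z\,\psi(z^n)$ is a pseudo-real rational map, and $$\mathrm{Aut}(\phi)=\langle\, T(z)=\omega_n z\,\rangle\cong\mathbb Z_n .$$ -/

import Mathlib

noncomputable section

namespace PseudoRealMaps

open Polynomial

/-- The point `u / v` of the Riemann sphere, read as `∞` when `v = 0`
(used only for pairs `(u, v) ≠ (0, 0)`). -/
def ratio (u v : ℂ) : OnePoint ℂ :=
  if v = 0 then OnePoint.infty else ((u / v : ℂ) : OnePoint ℂ)

/-- The degree of a rational map: the larger of the degrees of the numerator and denominator in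
lowest terms. -/
def degree (φ : RatFunc ℂ) : ℕ := max φ.num.natDegree φ.denom.natDegree

/-- The self-map of the Riemann sphere `ℂ ∪ {∞}` defined by a rational function. With
`φ = (∑ a_k z^k) / (∑ b_k z^k)` of degree `d` in lowest terms, the value at `∞` is `a_d / b_d`. -/
def sphereMap (φ : RatFunc ℂ) : OnePoint ℂ → OnePoint ℂ
  | OnePoint.infty => ratio (φ.num.coeff (degree φ)) (φ.denom.coeff (degree φ))
  | OnePoint.some z => ratio (φ.num.eval z) (φ.denom.eval z)

/-- The extension of a bijection of `ℂ` to the Riemann sphere, fixing `∞`. -/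
def extend (e : ℂ ≃ ℂ) : Equiv.Perm (OnePoint ℂ) where
  toFun := OnePoint.map e
  invFun := OnePoint.map e.symm
  left_inv x := by induction x using OnePoint.rec <;> simp
  right_inv x := by induction x using OnePoint.rec <;> simp

/-- The group `PSL₂(ℂ)` of Möbius transformations of the Riemann sphere
(Mathlib's action of `GL₂` by `z ↦ (a z + b) / (c z + d)`). -/
def moebius : Subgroup (Equiv.Perm (OnePoint ℂ)) :=
  (MulAction.toPermHom (GL (Fin 2) ℂ) (OnePoint ℂ)).range

/-- Complex conjugation `J(z) = z̄` on the Riemann sphere. -/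
def J : Equiv.Perm (OnePoint ℂ) := extend (starRingAut (R := ℂ)).toEquiv

/-- Extended Möbius transformations `T ∘ J`, i.e. the antiholomorphic automorphisms of the
Riemann sphere. -/
def IsExtendedMoebius (Q : Equiv.Perm (OnePoint ℂ)) : Prop := ∃ T ∈ moebius, Q = T * J

/-- `Aut(φ)`: the group of Möbius transformations `T` with `T ∘ φ ∘ T⁻¹ = φ`. -/
def Aut (φ : RatFunc ℂ) : Subgroup (Equiv.Perm (OnePoint ℂ)) where
  carrier := {T | T ∈ moebius ∧ ⇑T ∘ sphereMap φ ∘ ⇑T⁻¹ = sphereMap φ}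
  one_mem' := ⟨moebius.one_mem, rfl⟩
  mul_mem' := by
    rintro S T ⟨hS, hS'⟩ ⟨hT, hT'⟩
    refine ⟨moebius.mul_mem hS hT, ?_⟩
    conv_rhs => rw [← hS', ← hT']
    rw [mul_inv_rev]
    rfl
  inv_mem' := by
    rintro T ⟨hT, hT'⟩
    refine ⟨moebius.inv_mem hT, ?_⟩
    conv_lhs => rw [← hT']
    funext x
    simp

/-- `Q` is an antiholomorphic automorphism of `φ`. -/
def IsAntiholomorphicAut (φ : RatFunc ℂ) (Q : Equiv.Perm (OnePoint ℂ)) : Prop :=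
  IsExtendedMoebius Q ∧ ⇑Q ∘ sphereMap φ ∘ ⇑Q⁻¹ = sphereMap φ

/-- `φ ∼ η`: `η = T ∘ φ ∘ T⁻¹` for some Möbius transformation `T`. -/
def Equivalent (φ η : RatFunc ℂ) : Prop :=
  ∃ T ∈ moebius, sphereMap η = ⇑T ∘ sphereMap φ ∘ ⇑T⁻¹

/-- `η` is a quotient of polynomials with real coefficients. -/
def HasRealCoefficients (η : RatFunc ℂ) : Prop :=
  ∃ p q : ℝ[X], q ≠ 0 ∧
    η = algebraMap ℂ[X] (RatFunc ℂ) (p.map Complex.ofRealHom) /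
      algebraMap ℂ[X] (RatFunc ℂ) (q.map Complex.ofRealHom)

/-- `φ` is real: it is conjugate to a rational map with real coefficients. -/
def IsReal (φ : RatFunc ℂ) : Prop := ∃ η : RatFunc ℂ, HasRealCoefficients η ∧ Equivalent φ η

/-- `φ` is pseudo-real: it admits an antiholomorphic automorphism but is not real. -/
def IsPseudoReal (φ : RatFunc ℂ) : Prop := (∃ Q, IsAntiholomorphicAut φ Q) ∧ ¬ IsReal φ

/-- The primitive root of unity `ω_n = e^{2πi/n}`. -/
def omega (n : ℕ) : ℂ := Complex.exp (2 * Real.pi * Complex.I / n)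

/-- The rotation `T(z) = ω_n z` of the Riemann sphere. -/
def rotation (n : ℕ) : Equiv.Perm (OnePoint ℂ) :=
  extend (Equiv.mulLeft₀ (omega n) (Complex.exp_ne_zero _))

/-- The polynomial `∑_{k=0}^{r} a_k z^k`. -/
def numerator (r : ℕ) (a : ℕ → ℂ) : ℂ[X] := ∑ k ∈ Finset.range (r + 1), C (a k) * X ^ k

/-- The polynomial `∑_{k=0}^{r} (-1)^k e^{iθ} conj(a_{r-k}) z^k`. -/
def denominator (r : ℕ) (θ : ℝ) (a : ℕ → ℂ) : ℂ[X] :=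
  ∑ k ∈ Finset.range (r + 1),
    C ((-1) ^ k * Complex.exp (θ * Complex.I) * star (a (r - k))) * X ^ k

end PseudoRealMaps

end

/-!
The idea is to compute `Aut φ` from the geometry of its action on the fixed points of `φ`, and to
read pseudo-reality off the result.

Every automorphism permutes the finite set of fixed points of `φ`, which contains `0` and `∞`. If an
automorphism does not preserve `{0, ∞}`, then `φ` has a third fixed point, so `Aut φ` acts
faithfully on a finite set and is finite. A finite group of Möbius transformations containing
`T(z) = ω_n z` with `n ≥ 6` nevertheless preserves `{0, ∞}`
(`diagonal_or_antidiagonal_of_finite`). To see this, attach to `g = [[a, b], [c, d]]` the cross-ratio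
`x = b c / (a d - b c)`. Passing from `g` to `g T g⁻¹` replaces `x` by `κ x (1 + x)`, where
`κ = |ω_n - 1|² ∈ (0, 1]`, and the commutator of `g` and `T` has trace `2 + κ x`. That commutator
has finite order and determinant `1`, so its trace is real and at most `2`, and `x` is real and
nonpositive. Then `x ≥ -1`, since `κ x (1 + x)` is nonpositive too, and a value `x ∈ (-1, 0)`
would produce a larger value in the same interval, against finiteness. So `x` is `0` or `-1`, and the
remaining degenerate matrices are excluded because parabolic elements have infinite order. The bound
`n ≥ 6` enters as `κ ≤ 1`.

It remains to look at `z ↦ u z` and `z ↦ u / z`. The former commutes with `φ` only if `uⁿ = 1`,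
because the numerator of `ψ` has nonzero coefficients in degrees `0` and `1`
(`IsTwisted.pow_eq_one_of_scaling_mem_Aut`). The latter would equate the multipliers of `φ` at `0`
and `∞`, which differ by hypothesis (`IsTwisted.inversion_notMem_Aut`).

For any `c` with `cⁿ = -1`, the map `z ↦ c / z̄` commutes with `φ`; this is what the shape of the
denominator and the parity of `r` provide (`IsTwisted.isAntiholomorphicAut`). If `φ` were real, it
would also commute with a reflection `R = T⁻¹ J T`, which has fixed points. The composite of
`z ↦ c / z̄` and `R` is a rotation `z ↦ ω_n^k z`, so `c |y|² = ω_n^k |x|²` at a fixed point `x / y`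
of `R`, and taking `n`-th powers gives `-|y|^(2n) = |x|^(2n)`, which is impossible
(`not_isReal_of_isAntiholomorphicAut`).
-/

open Polynomial

namespace PseudoRealMaps

/-! ### Homogeneous coordinates on the Riemann sphere -/

lemma ratio_eq_ratio_iff {u v u' v' : ℂ} (h : u ≠ 0 ∨ v ≠ 0) (h' : u' ≠ 0 ∨ v' ≠ 0) :
    ratio u v = ratio u' v' ↔ u * v' = u' * v := by
  unfold ratio
  by_cases hv : v = 0 <;> by_cases hv' : v' = 0
  · simp [hv, hv']
  · have hu : u ≠ 0 := by tauto
    simp [hv, hv', hu]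
  · have hu : u' ≠ 0 := by tauto
    simp [hv, hv', hu]
  · simp [hv, hv', div_eq_div_iff]

lemma exists_eq_ratio (p : OnePoint ℂ) : ∃ x y : ℂ, (x ≠ 0 ∨ y ≠ 0) ∧ p = ratio x y := by
  induction p using OnePoint.rec with
  | infty => exact ⟨1, 0, by simp, by simp [ratio]⟩
  | coe z => exact ⟨z, 1, by simp, by simp [ratio]⟩

lemma ratio_mul_left {c : ℂ} (hc : c ≠ 0) (u v : ℂ) : ratio (c * u) (c * v) = ratio u v := by
  unfold ratio
  by_cases hv : v = 0
  · simp [hv]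
  · simp [hv, hc, mul_div_mul_left]

@[simp] lemma ratio_one_right (z : ℂ) : ratio z 1 = z := by simp [ratio]

lemma ratio_zero_right (z : ℂ) : ratio z 0 = OnePoint.infty := by simp [ratio]

lemma linear_ne_zero (g : GL (Fin 2) ℂ) {x y : ℂ} (h : x ≠ 0 ∨ y ≠ 0) :
    g 0 0 * x + g 0 1 * y ≠ 0 ∨ g 1 0 * x + g 1 1 * y ≠ 0 := by
  by_contra! hc
  have hD := g.det_ne_zero
  rw [Matrix.det_fin_two] at hD
  have hx : (g 0 0 * g 1 1 - g 0 1 * g 1 0) * x = 0 := by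
    linear_combination g 1 1 * hc.1 - g 0 1 * hc.2
  have hy : (g 0 0 * g 1 1 - g 0 1 * g 1 0) * y = 0 := by
    linear_combination g 0 0 * hc.2 - g 1 0 * hc.1
  simp_all

lemma smul_ratio (g : GL (Fin 2) ℂ) {x y : ℂ} (h : x ≠ 0 ∨ y ≠ 0) :
    g • ratio x y = ratio (g 0 0 * x + g 0 1 * y) (g 1 0 * x + g 1 1 * y) := by
  by_cases hy : y = 0
  · have hx : x ≠ 0 := by tauto
    subst hy
    rw [ratio_zero_right, OnePoint.smul_infty_eq_ite]
    simp [ratio, hx, mul_div_mul_right]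
  · have : ratio x y = ((x / y : ℂ) : OnePoint ℂ) := by simp [ratio, hy]
    rw [this, OnePoint.smul_some_eq_ite]
    have e1 : g 1 0 * x + g 1 1 * y = (g 1 0 * (x / y) + g 1 1) * y := by field_simp
    have e0 : g 0 0 * x + g 0 1 * y = (g 0 0 * (x / y) + g 0 1) * y := by field_simp
    rw [e1, e0]
    simp only [ratio, mul_eq_zero, hy, or_false, mul_div_mul_right _ _ hy]

lemma J_ratio (x y : ℂ) : J (ratio x y) = ratio (star x) (star y) := by
  have : ∀ p, J p = OnePoint.map (starRingAut (R := ℂ)) p := fun _ => rfl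
  rw [this]
  unfold ratio
  by_cases hy : y = 0 <;> simp [hy, OnePoint.map_infty, OnePoint.map_some]

/-- The Möbius transformation given by an invertible matrix, as a permutation of the sphere. -/
noncomputable abbrev toMoebius : GL (Fin 2) ℂ →* Equiv.Perm (OnePoint ℂ) :=
  MulAction.toPermHom (GL (Fin 2) ℂ) (OnePoint ℂ)

lemma J_mul_mul_J_mem {T : Equiv.Perm (OnePoint ℂ)} (hT : T ∈ moebius) : J * T * J ∈ moebius := by
  obtain ⟨g, rfl⟩ := hT
  refine ⟨g.map (starRingEnd ℂ), ?_⟩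
  ext p
  obtain ⟨x, y, h, rfl⟩ := exists_eq_ratio p
  have h' : star x ≠ 0 ∨ star y ≠ 0 := by simpa using h
  simp only [MulAction.toPermHom_apply, MulAction.toPerm_apply, Equiv.Perm.coe_mul,
    Function.comp_apply, J_ratio, smul_ratio _ h, smul_ratio _ h']
  simp

/-- The matrix `diag(u, 1)`, which represents `z ↦ u z`. -/
noncomputable def scaling (u : ℂ) (hu : u ≠ 0) : GL (Fin 2) ℂ :=
  Matrix.GeneralLinearGroup.mkOfDetNeZero !![u, 0; 0, 1] (by simpa [Matrix.det_fin_two] using hu)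

/-- The antidiagonal matrix that represents `z ↦ u / z`. -/
noncomputable def inversion (u : ℂ) (hu : u ≠ 0) : GL (Fin 2) ℂ :=
  Matrix.GeneralLinearGroup.mkOfDetNeZero !![0, u; 1, 0] (by simpa [Matrix.det_fin_two] using hu)

lemma scaling_smul_ratio {u : ℂ} (hu : u ≠ 0) {x y : ℂ} (h : x ≠ 0 ∨ y ≠ 0) :
    scaling u hu • ratio x y = ratio (u * x) y := by
  rw [smul_ratio _ h]
  simp [scaling, Matrix.GeneralLinearGroup.mkOfDetNeZero]

lemma inversion_smul_ratio {u : ℂ} (hu : u ≠ 0) {x y : ℂ} (h : x ≠ 0 ∨ y ≠ 0) :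
    inversion u hu • ratio x y = ratio (u * y) x := by
  rw [smul_ratio _ h]
  simp [inversion, Matrix.GeneralLinearGroup.mkOfDetNeZero]

lemma omega_ne_zero (n : ℕ) : omega n ≠ 0 := Complex.exp_ne_zero _

lemma isPrimitiveRoot_omega {n : ℕ} (hn : n ≠ 0) : IsPrimitiveRoot (omega n) n :=
  Complex.isPrimitiveRoot_exp n hn

lemma rotation_eq (n : ℕ) : rotation n = toMoebius (scaling (omega n) (omega_ne_zero n)) := by
  ext p
  have : ∀ p, rotation n p = OnePoint.map (fun z => omega n * z) p := fun _ => rfl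
  rw [this]
  induction p using OnePoint.rec with
  | infty =>
    rw [← ratio_zero_right 1]
    simp only [MulAction.toPermHom_apply, MulAction.toPerm_apply]
    rw [scaling_smul_ratio _ (by simp)]
    simp [ratio]
  | coe z =>
    rw [← ratio_one_right z]
    simp only [MulAction.toPermHom_apply, MulAction.toPerm_apply]
    rw [scaling_smul_ratio _ (by simp)]
    simp

lemma rotation_ratio (n : ℕ) {x y : ℂ} (h : x ≠ 0 ∨ y ≠ 0) :
    rotation n (ratio x y) = ratio (omega n * x) y := by
  rw [rotation_eq]
  exact scaling_smul_ratio _ h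

lemma rotation_pow_ratio (n k : ℕ) {x y : ℂ} (h : x ≠ 0 ∨ y ≠ 0) :
    (rotation n ^ k) (ratio x y) = ratio (omega n ^ k * x) y := by
  induction k with
  | zero => simp
  | succ k ih =>
    rw [pow_succ', Equiv.Perm.mul_apply, ih, rotation_ratio, pow_succ', mul_assoc]
    simpa [omega_ne_zero] using h

lemma rotation_pow_eq_one_iff (n k : ℕ) : rotation n ^ k = 1 ↔ omega n ^ k = 1 := by
  constructor
  · intro h
    have h2 := rotation_pow_ratio n k (x := 1) (y := 1) (by simp)
    rw [h, Equiv.Perm.one_apply, ratio_eq_ratio_iff (by simp) (by simp)] at h2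
    simpa using h2.symm
  · intro h
    ext p
    obtain ⟨x, y, hxy, rfl⟩ := exists_eq_ratio p
    simp [rotation_pow_ratio n k hxy, h]

lemma orderOf_rotation {n : ℕ} (hn : n ≠ 0) : orderOf (rotation n) = n :=
  (orderOf_eq_orderOf_iff.2 (rotation_pow_eq_one_iff n)).trans
    (isPrimitiveRoot_omega hn).eq_orderOf.symm

lemma toMoebius_eq_one_iff {g : GL (Fin 2) ℂ} :
    toMoebius g = 1 ↔ g 0 1 = 0 ∧ g 1 0 = 0 ∧ g 0 0 = g 1 1 := by
  constructor
  · intro h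
    have key : ∀ x y : ℂ, (x ≠ 0 ∨ y ≠ 0) →
        (g 0 0 * x + g 0 1 * y) * y = x * (g 1 0 * x + g 1 1 * y) := by
      intro x y hxy
      rw [← ratio_eq_ratio_iff (linear_ne_zero g hxy) hxy, ← smul_ratio g hxy]
      exact DFunLike.congr_fun h (ratio x y)
    have e0 := key 0 1 (by simp)
    have e1 := key 1 0 (by simp)
    have e2 := key 1 1 (by simp)
    simp only [mul_zero, mul_one, zero_add, one_mul, zero_mul, add_zero] at e0 e1 e2
    refine ⟨e0, e1.symm, ?_⟩
    rwa [e0, ← e1, add_zero, zero_add] at e2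
  · rintro ⟨hb, hc, hd⟩
    ext p
    obtain ⟨x, y, hxy, rfl⟩ := exists_eq_ratio p
    have := linear_ne_zero g hxy
    simp only [MulAction.toPermHom_apply, MulAction.toPerm_apply, Equiv.Perm.one_apply]
    rw [smul_ratio g hxy, ratio_eq_ratio_iff this hxy, hb, hc, hd]
    ring

/-! ### Groups of Möbius transformations containing a rotation of order at least six -/

/-- An element of `SL₂(ℂ)` of finite order modulo scalars has real trace at most `2`, because its
eigenvalues are roots of unity `μ, μ⁻¹`. -/
lemma trace_eq_real_of_pow_eq_scalar {K : Matrix (Fin 2) (Fin 2) ℂ} (hdet : K.det = 1) {m : ℕ}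
    (hm : m ≠ 0) {s : ℂ} (hK : K ^ m = Matrix.scalar (Fin 2) s) :
    ∃ t : ℝ, t ≤ 2 ∧ K.trace = t := by
  obtain ⟨μ, hμ⟩ : ∃ μ : ℂ, μ * μ - K.trace * μ + 1 = 0 := by
    obtain ⟨μ, hμ⟩ := IsAlgClosed.exists_root (k := ℂ) (X ^ 2 - C K.trace * X + 1 : ℂ[X]) (by
      have : (X ^ 2 - C K.trace * X + 1 : ℂ[X]).degree = 2 := by compute_degree!
      rw [this]; simp)
    refine ⟨μ, ?_⟩
    simpa [IsRoot, sq] using hμ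
  have hμ0 : μ ≠ 0 := by rintro rfl; simp at hμ
  obtain ⟨v, hv0, hv⟩ := Matrix.exists_mulVec_eq_zero_iff (M := K - Matrix.scalar (Fin 2) μ) |>.2 (by
    rw [Matrix.det_fin_two] at hdet ⊢
    rw [Matrix.trace_fin_two] at hμ
    simp only [Matrix.sub_apply, Matrix.scalar_apply, Matrix.diagonal_apply_eq, ne_eq, zero_ne_one,
      one_ne_zero, not_false_eq_true, Matrix.diagonal_apply_ne, sub_zero]
    linear_combination hdet + hμ)
  have hKv : K.mulVec v = μ • v := by
    rw [Matrix.sub_mulVec, sub_eq_zero] at hv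
    rw [hv]
    ext i
    simp [Matrix.mulVec_diagonal]
  have hpow : ∀ k : ℕ, (K ^ k).mulVec v = μ ^ k • v := by
    intro k
    induction k with
    | zero => simp
    | succ k ih =>
      rw [pow_succ, ← Matrix.mulVec_mulVec, hKv, Matrix.mulVec_smul, ih, smul_smul, pow_succ']
  have hμs : μ ^ m = s := by
    have h := hpow m
    rw [hK] at h
    obtain ⟨i, hi⟩ := Function.ne_iff.1 hv0
    have h2 := congrFun h i
    simp only [Matrix.scalar_apply, Matrix.mulVec_diagonal, Pi.smul_apply, smul_eq_mul] at h2
    exact (mul_right_cancel₀ hi h2).symm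
  have hs : s ^ 2 = 1 := by
    have h := congrArg Matrix.det hK
    simpa [Matrix.det_pow, hdet, Matrix.det_fin_two, sq] using h.symm
  have hnorm : ‖μ‖ = 1 := by
    refine Complex.norm_eq_one_of_pow_eq_one (n := m * 2) (by rw [pow_mul, hμs, hs]) ?_
    simpa using hm
  have hinv : μ⁻¹ = star μ := by
    rw [Complex.inv_def, Complex.normSq_eq_norm_sq, hnorm]; simp
  have htr : K.trace = μ + star μ := by
    rw [← hinv]; field_simp; linear_combination -hμ
  refine ⟨2 * μ.re, ?_, ?_⟩
  · have := Complex.re_le_norm μ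
    linarith
  · rw [htr]
    exact Complex.add_conj μ

/-- The cross-ratio `b c / (a d - b c)` attached to `[[a, b], [c, d]]`: it depends only on the
Möbius transformation `g`, and it compares the pair `{0, ∞}` with its image under `g`. -/
noncomputable def crossRatio (g : GL (Fin 2) ℂ) : ℂ :=
  g 0 1 * g 1 0 / (g 0 0 * g 1 1 - g 0 1 * g 1 0)

lemma crossRatio_eq_of_toMoebius_eq {g h : GL (Fin 2) ℂ} (hgh : toMoebius g = toMoebius h) :
    crossRatio g = crossRatio h := by
  obtain ⟨s, hs, rfl⟩ : ∃ s : GL (Fin 2) ℂ, toMoebius s = 1 ∧ h = g * s :=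
    ⟨g⁻¹ * h, by rw [map_mul, map_inv, hgh, inv_mul_cancel], by group⟩
  rw [toMoebius_eq_one_iff] at hs
  obtain ⟨hb, hc, hd⟩ := hs
  have hs1 : s 1 1 ≠ 0 := by
    have := s.det_ne_zero
    rw [Matrix.det_fin_two, hb, hd] at this
    simp_all
  unfold crossRatio
  simp only [Units.val_mul, Matrix.mul_apply, Fin.sum_univ_two, hb, hc, hd, mul_zero,
    add_zero, zero_add]
  rw [show g 0 1 * s 1 1 * (g 1 0 * s 1 1) = (g 0 1 * g 1 0) * (s 1 1 * s 1 1) by ring,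
    show g 0 0 * s 1 1 * (g 1 1 * s 1 1) - (g 0 1 * g 1 0) * (s 1 1 * s 1 1) =
      (g 0 0 * g 1 1 - g 0 1 * g 1 0) * (s 1 1 * s 1 1) by ring,
    mul_div_mul_right _ _ (mul_ne_zero hs1 hs1)]

lemma conj_scaling_apply (g : GL (Fin 2) ℂ) {u : ℂ} (hu : u ≠ 0) :
    ((g * scaling u hu * g⁻¹ : GL (Fin 2) ℂ) : Matrix (Fin 2) (Fin 2) ℂ) =
      (g 0 0 * g 1 1 - g 0 1 * g 1 0)⁻¹ •
        !![u * (g 0 0 * g 1 1) - g 0 1 * g 1 0, (1 - u) * (g 0 0 * g 0 1);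
          (u - 1) * (g 1 0 * g 1 1), g 0 0 * g 1 1 - u * (g 0 1 * g 1 0)] := by
  have hD := g.det_ne_zero
  have hs : (scaling u hu : Matrix (Fin 2) (Fin 2) ℂ) = !![u, 0; 0, 1] := rfl
  rw [Units.val_mul, Units.val_mul, Matrix.coe_units_inv, Matrix.inv_def, Matrix.adjugate_fin_two,
    Ring.inverse_eq_inv', Matrix.det_fin_two, hs, Matrix.mul_smul]
  congr 1
  rw [Matrix.eta_fin_two g.val]
  ext i j
  fin_cases i <;> fin_cases j <;> simp [Matrix.mul_apply, Fin.sum_univ_two] <;> ring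

/-- The effect on the cross-ratio `x` of replacing `g` by `g T g⁻¹`, where `T(z) = u z`:
it becomes `κ x (1 + x)` with `κ = 2 - u - u⁻¹`. -/
lemma crossRatio_conj_scaling (g : GL (Fin 2) ℂ) {u : ℂ} (hu : u ≠ 0) :
    crossRatio (g * scaling u hu * g⁻¹) =
      (2 - u - u⁻¹) * (crossRatio g * (1 + crossRatio g)) := by
  have hD := g.det_ne_zero
  rw [Matrix.det_fin_two] at hD
  unfold crossRatio
  rw [conj_scaling_apply]
  simp only [Matrix.smul_apply, Matrix.of_apply, Matrix.cons_val', Matrix.cons_val_zero,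
    Matrix.cons_val_one, Matrix.cons_val_fin_one, smul_eq_mul]
  generalize g 0 0 = a at *
  generalize g 0 1 = b at *
  generalize g 1 0 = c at *
  generalize g 1 1 = d at *
  have e : (a * d - b * c)⁻¹ * (u * (a * d) - b * c) * ((a * d - b * c)⁻¹ * (a * d - u * (b * c))) -
      (a * d - b * c)⁻¹ * ((1 - u) * (a * b)) * ((a * d - b * c)⁻¹ * ((u - 1) * (c * d))) = u := by
    field_simp; ring
  rw [e]
  field_simp
  ring

lemma det_commutator_scaling (g : GL (Fin 2) ℂ) {u : ℂ} (hu : u ≠ 0) :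
    (g * scaling u hu * g⁻¹ * (scaling u hu)⁻¹).val.det = 1 := by
  have hg := g.det_ne_zero
  have hs := (scaling u hu).det_ne_zero
  simp only [Units.val_mul, Matrix.det_mul, Matrix.coe_units_inv, Matrix.det_nonsing_inv,
    Ring.inverse_eq_inv']
  field_simp

lemma commutator_scaling_apply (g : GL (Fin 2) ℂ) {u : ℂ} (hu : u ≠ 0) :
    ((g * scaling u hu * g⁻¹ * (scaling u hu)⁻¹ : GL (Fin 2) ℂ) : Matrix (Fin 2) (Fin 2) ℂ) =
      (g 0 0 * g 1 1 - g 0 1 * g 1 0)⁻¹ •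
        !![g 0 0 * g 1 1 - u⁻¹ * (g 0 1 * g 1 0), (1 - u) * (g 0 0 * g 0 1);
          (1 - u⁻¹) * (g 1 0 * g 1 1), g 0 0 * g 1 1 - u * (g 0 1 * g 1 0)] := by
  have hs : ((scaling u hu)⁻¹ : GL (Fin 2) ℂ).val = !![u⁻¹, 0; 0, 1] := by
    rw [← Units.mul_right_inj (scaling u hu), ← Units.val_mul, mul_inv_cancel]
    have hs : (scaling u hu : Matrix (Fin 2) (Fin 2) ℂ) = !![u, 0; 0, 1] := rfl
    rw [hs]
    simp [hu, Matrix.one_fin_two]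
  rw [Units.val_mul, conj_scaling_apply, hs, Matrix.smul_mul]
  congr 1
  ext i j
  fin_cases i <;> fin_cases j <;> simp [Matrix.mul_apply, Fin.sum_univ_two] <;> field_simp

lemma trace_commutator_scaling (g : GL (Fin 2) ℂ) {u : ℂ} (hu : u ≠ 0) :
    (g * scaling u hu * g⁻¹ * (scaling u hu)⁻¹).val.trace =
      2 + (2 - u - u⁻¹) * crossRatio g := by
  have hD := g.det_ne_zero
  rw [Matrix.det_fin_two] at hD
  rw [commutator_scaling_apply, Matrix.trace_fin_two]
  unfold crossRatio
  simp only [Matrix.smul_apply, Matrix.of_apply, Matrix.cons_val', Matrix.cons_val_zero,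
    Matrix.cons_val_one, Matrix.cons_val_fin_one, smul_eq_mul]
  field_simp
  ring

/-- The number `κ = 2 - ω_n - ω_n⁻¹ = |ω_n - 1|²` lies in `(0, 1]` when `n ≥ 6`. -/
lemma exists_two_sub_omega {n : ℕ} (hn : 6 ≤ n) :
    ∃ κ : ℝ, 0 < κ ∧ κ ≤ 1 ∧ 2 - omega n - (omega n)⁻¹ = κ := by
  have hn' : (6 : ℝ) ≤ n := by exact_mod_cast hn
  have hpi := Real.pi_pos
  set x : ℝ := 2 * Real.pi / n with hx
  have hx0 : 0 < x := by positivity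
  have hx3 : x ≤ Real.pi / 3 := by
    rw [hx, div_le_div_iff₀ (by linarith) (by norm_num)]
    nlinarith
  have hω : omega n = Complex.exp (x * Complex.I) := by
    unfold omega
    congr 1
    rw [hx]
    push_cast
    ring
  refine ⟨2 - 2 * Real.cos x, ?_, ?_, ?_⟩
  · have : Real.cos x < Real.cos 0 :=
      Real.cos_lt_cos_of_nonneg_of_le_pi le_rfl (by linarith) hx0
    rw [Real.cos_zero] at this
    linarith
  · have : Real.cos (Real.pi / 3) ≤ Real.cos x :=
      Real.cos_le_cos_of_nonneg_of_le_pi hx0.le (by linarith) hx3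
    rw [Real.cos_pi_div_three] at this
    linarith
  · rw [hω, ← Complex.exp_neg]
    push_cast
    rw [Complex.cos]
    ring_nf

/-- A finite-order element of `PSL₂(ℂ)`, lifted to `GL₂(ℂ)`, has a scalar power. -/
lemma exists_pow_eq_scalar {Γ : Subgroup (GL (Fin 2) ℂ)} (hfin : Finite (Γ.map toMoebius))
    {g : GL (Fin 2) ℂ} (hg : g ∈ Γ) :
    ∃ m ≠ 0, ∃ s : ℂ, (g ^ m).val = Matrix.scalar (Fin 2) s := by
  obtain ⟨m, hm, hpow⟩ := isOfFinOrder_iff_pow_eq_one.1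
    (isOfFinOrder_of_finite (⟨toMoebius g, Subgroup.mem_map_of_mem _ hg⟩ : Γ.map toMoebius))
  refine ⟨m, hm.ne', (g ^ m) 0 0, ?_⟩
  have h1 : toMoebius (g ^ m) = 1 := by
    rw [map_pow]
    exact congrArg Subtype.val hpow
  obtain ⟨hb, hc, hd⟩ := toMoebius_eq_one_iff.1 h1
  ext i j
  fin_cases i <;> fin_cases j <;> simp [hb, hc, hd]

/-- Cross-ratios over a finite group of Möbius transformations containing a rotation of order at
least six take only the values `0` and `-1`. Traces of commutators with the rotation force these
cross-ratios to be nonpositive reals; the map `x ↦ κ x (1 + x)`, which preserves the set of values,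
rules out `x < -1` and strictly increases every `x ∈ (-1, 0)`. -/
lemma crossRatio_eq_zero_or_neg_one {n : ℕ} (hn : 6 ≤ n) {Γ : Subgroup (GL (Fin 2) ℂ)}
    (hfin : Finite (Γ.map toMoebius)) (hT : scaling (omega n) (omega_ne_zero n) ∈ Γ)
    {g : GL (Fin 2) ℂ} (hg : g ∈ Γ) : crossRatio g = 0 ∨ crossRatio g = -1 := by
  obtain ⟨κ, hκ0, hκ1, hκ⟩ := exists_two_sub_omega hn
  set T := scaling (omega n) (omega_ne_zero n)
  have hstep : ∀ h ∈ Γ, ∃ h' ∈ Γ, crossRatio h' = κ * (crossRatio h * (1 + crossRatio h)) :=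
    fun h hh => ⟨h * T * h⁻¹, Γ.mul_mem (Γ.mul_mem hh hT) (Γ.inv_mem hh), by
      rw [crossRatio_conj_scaling, hκ]⟩
  have hreal : ∀ h ∈ Γ, ∃ x : ℝ, x ≤ 0 ∧ crossRatio h = x := by
    intro h hh
    obtain ⟨m, hm, s, hs⟩ := exists_pow_eq_scalar hfin
      (Γ.mul_mem (Γ.mul_mem (Γ.mul_mem hh hT) (Γ.inv_mem hh)) (Γ.inv_mem hT))
    rw [Units.val_pow_eq_pow_val] at hs
    obtain ⟨t, ht2, ht⟩ := trace_eq_real_of_pow_eq_scalar (det_commutator_scaling h _) hm hs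
    rw [trace_commutator_scaling, hκ] at ht
    refine ⟨(t - 2) / κ, div_nonpos_of_nonpos_of_nonneg (by linarith) hκ0.le, ?_⟩
    have : (κ : ℂ) ≠ 0 := by exact_mod_cast hκ0.ne'
    push_cast
    rw [← ht]
    field_simp
    ring
  have hge : ∀ h ∈ Γ, ∀ x : ℝ, crossRatio h = x → -1 ≤ x := by
    intro h hh x hx
    obtain ⟨h', hh', e⟩ := hstep h hh
    obtain ⟨y, hy, hy'⟩ := hreal h' hh'
    obtain ⟨z, hz, hz'⟩ := hreal h hh
    have hxz : x = z := by exact_mod_cast hx.symm.trans hz'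
    rw [hy', hx] at e
    have e' : y = κ * (x * (1 + x)) := by exact_mod_cast e
    by_contra! hlt
    have : 0 < κ * (x * (1 + x)) := mul_pos hκ0 (mul_pos_of_neg_of_neg (by linarith) (by linarith))
    linarith
  -- The values in `(-1, 0)` form a finite set without a largest element.
  let S : Set ℝ := {x | -1 < x ∧ x < 0 ∧ ∃ h ∈ Γ, crossRatio h = x}
  have hSfin : S.Finite := by
    classical
    have hrange : (crossRatio '' (Γ : Set (GL (Fin 2) ℂ))).Finite := by
      have himg : ((Γ.map toMoebius : Subgroup _) : Set (Equiv.Perm (OnePoint ℂ))).Finite :=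
        Set.toFinite _
      rw [Subgroup.coe_map] at himg
      obtain ⟨f, hf⟩ : ∃ f : Equiv.Perm (OnePoint ℂ) → ℂ, ∀ h, f (toMoebius h) = crossRatio h :=
        ⟨Function.extend toMoebius crossRatio 0, fun h =>
          Function.FactorsThrough.extend_apply (fun _ _ => crossRatio_eq_of_toMoebius_eq) 0 h⟩
      refine (himg.image f).subset ?_
      rintro _ ⟨h, hh, rfl⟩
      exact ⟨toMoebius h, ⟨h, hh, rfl⟩, hf h⟩
    refine (hrange.preimage (f := ((↑) : ℝ → ℂ)) Complex.ofReal_injective.injOn).subset ?_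
    rintro x ⟨-, -, h, hh, hx⟩
    exact ⟨h, hh, hx⟩
  have hSempty : S = ∅ := by
    by_contra hne
    obtain ⟨x, ⟨hx1, hx0, h, hh, hx⟩, hmax⟩ :=
      Set.exists_max_image S id hSfin (Set.nonempty_iff_ne_empty.2 hne)
    obtain ⟨h', hh', e⟩ := hstep h hh
    have hlt : x < κ * (x * (1 + x)) := by
      nlinarith [mul_pos (neg_pos.2 hx0) (by linarith : 0 < 1 + x)]
    have hneg : κ * (x * (1 + x)) < 0 :=
      mul_neg_of_pos_of_neg hκ0 (mul_neg_of_neg_of_pos hx0 (by linarith))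
    have := hmax (κ * (x * (1 + x))) ⟨by linarith, hneg, h', hh', by rw [e, hx]; push_cast; rfl⟩
    exact absurd this (not_le.2 hlt)
  obtain ⟨x, hx0, hx⟩ := hreal g hg
  have hx1 := hge g hg x hx
  rw [hx]
  by_contra! hc
  have hxS : x ∈ S := ⟨lt_of_le_of_ne hx1 fun h => hc.2 (by rw [← h]; simp),
    lt_of_le_of_ne hx0 fun h => hc.1 (by rw [h]; simp), g, hg, hx⟩
  rw [hSempty] at hxS
  exact hxS

/-- If the cross-ratio of `g` vanishes, the commutator of `g` with the rotation is either scalar or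
parabolic, and only the former is possible in a finite group. The products below are, up to nonzero
factors, the off-diagonal entries of this commutator. -/
lemma row_products_eq_zero_of_crossRatio_eq_zero {n : ℕ} (hn : 6 ≤ n) {Γ : Subgroup (GL (Fin 2) ℂ)}
    (hfin : Finite (Γ.map toMoebius)) (hT : scaling (omega n) (omega_ne_zero n) ∈ Γ)
    {g : GL (Fin 2) ℂ} (hg : g ∈ Γ) (h0 : crossRatio g = 0) :
    g 0 0 * g 0 1 = 0 ∧ g 1 0 * g 1 1 = 0 := by
  have hD := g.det_ne_zero
  rw [Matrix.det_fin_two] at hD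
  set T := scaling (omega n) (omega_ne_zero n)
  set K := g * T * g⁻¹ * T⁻¹ with hKdef
  have hω : omega n ≠ 1 := (isPrimitiveRoot_omega (by lia)).ne_one (by lia)
  have hdisc : K.val.discr = 0 := by
    rw [Matrix.discr_fin_two, trace_commutator_scaling, det_commutator_scaling, h0]
    norm_num
  have hscalar : K.val ∈ Set.range (Matrix.scalar (Fin 2)) := by
    by_contra hns
    have hpar : K.IsParabolic := ⟨hns, hdisc⟩
    obtain ⟨m, hm, s, hs⟩ := exists_pow_eq_scalar hfin
      (Γ.mul_mem (Γ.mul_mem (Γ.mul_mem hg hT) (Γ.inv_mem hg)) (Γ.inv_mem hT))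
    exact (hpar.pow hm).1 ⟨s, hs.symm⟩
  obtain ⟨s, hs⟩ := hscalar
  rw [hKdef, commutator_scaling_apply] at hs
  have h01 := congrFun (congrFun hs 0) 1
  have h10 := congrFun (congrFun hs 1) 0
  simp only [Matrix.scalar_apply, ne_eq, zero_ne_one, one_ne_zero, not_false_eq_true,
    Matrix.diagonal_apply_ne, Matrix.smul_apply, Matrix.of_apply, Matrix.cons_val',
    Matrix.cons_val_zero, Matrix.cons_val_one, Matrix.cons_val_fin_one, smul_eq_mul, zero_eq_mul,
    mul_eq_zero, inv_eq_zero, hD, false_or, sub_ne_zero.2 hω.symm,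
    sub_ne_zero.2 (inv_ne_one.2 hω).symm] at h01 h10
  simpa using And.intro h01 h10

/-- A finite group of Möbius transformations containing a rotation of order at least six about
`0` and `∞` preserves `{0, ∞}`. -/
theorem diagonal_or_antidiagonal_of_finite {n : ℕ} (hn : 6 ≤ n) {Γ : Subgroup (GL (Fin 2) ℂ)}
    (hfin : Finite (Γ.map toMoebius)) (hT : scaling (omega n) (omega_ne_zero n) ∈ Γ)
    {g : GL (Fin 2) ℂ} (hg : g ∈ Γ) : (g 0 1 = 0 ∧ g 1 0 = 0) ∨ (g 0 0 = 0 ∧ g 1 1 = 0) := by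
  have hD := g.det_ne_zero
  rw [Matrix.det_fin_two] at hD
  have hω : omega n ≠ 1 := (isPrimitiveRoot_omega (by lia)).ne_one (by lia)
  have key : g 0 0 * g 0 1 = 0 ∧ g 1 0 * g 1 1 = 0 := by
    rcases crossRatio_eq_zero_or_neg_one hn hfin hT hg with h0 | h1
    · exact row_products_eq_zero_of_crossRatio_eq_zero hn hfin hT hg h0
    · -- Here `a d = 0`, so the conjugate of the rotation by `g` has vanishing cross-ratio.
      have had : g 0 0 * g 1 1 = 0 := by
        rw [crossRatio, div_eq_iff hD] at h1
        linear_combination h1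
      have hconj := row_products_eq_zero_of_crossRatio_eq_zero hn hfin hT
        (Γ.mul_mem (Γ.mul_mem hg hT) (Γ.inv_mem hg)) (by rw [crossRatio_conj_scaling, h1]; simp)
      have hb : g 0 1 ≠ 0 := fun h => by simp [had, h] at hD
      have hc : g 1 0 ≠ 0 := fun h => by simp [had, h] at hD
      rw [conj_scaling_apply] at hconj
      simpa [hD, had, hb, hc, sub_eq_zero, hω, hω.symm, omega_ne_zero] using hconj
  by_cases ha : g 0 0 = 0
  · right
    refine ⟨ha, ?_⟩
    rcases mul_eq_zero.1 key.2 with h | h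
    · simp [ha, h] at hD
    · exact h
  · left
    have hb : g 0 1 = 0 := (mul_eq_zero.1 key.1).resolve_left ha
    refine ⟨hb, ?_⟩
    rcases mul_eq_zero.1 key.2 with h | h
    · exact h
    · simp [hb, h] at hD

/-! ### Rational maps as quotients of coprime polynomials -/

lemma exists_eq_C_mul_num_denom {u v : ℂ[X]} (huv : IsCoprime u v) (hv : v ≠ 0) {η : RatFunc ℂ}
    (hη : η = algebraMap ℂ[X] (RatFunc ℂ) u / algebraMap ℂ[X] (RatFunc ℂ) v) :
    ∃ c : ℂ, c ≠ 0 ∧ u = C c * η.num ∧ v = C c * η.denom := by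
  have hd := η.denom_ne_zero
  have hcross : η.num * v = u * η.denom := by
    apply RatFunc.algebraMap_injective ℂ
    have h := η.num_div_denom.trans hη
    rw [div_eq_div_iff (RatFunc.algebraMap_ne_zero hd) (RatFunc.algebraMap_ne_zero hv)] at h
    simpa only [map_mul] using h
  have h1 : η.denom ∣ v :=
    η.isCoprime_num_denom.symm.dvd_of_dvd_mul_left ⟨u, by rw [hcross, mul_comm]⟩
  have h2 : v ∣ η.denom := huv.symm.dvd_of_dvd_mul_left ⟨η.num, by rw [← hcross, mul_comm]⟩
  obtain ⟨w, hw⟩ := associated_of_dvd_dvd h1 h2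
  obtain ⟨c, hc, hcw⟩ := Polynomial.isUnit_iff.1 w.isUnit
  refine ⟨c, hc.ne_zero, ?_, by rw [hcw, mul_comm, hw]⟩
  rw [← hw, ← hcw] at hcross
  exact mul_right_cancel₀ hd (by linear_combination -hcross)

lemma sphereMap_coe_of_eq_div {u v : ℂ[X]} (huv : IsCoprime u v) (hv : v ≠ 0) {η : RatFunc ℂ}
    (hη : η = algebraMap ℂ[X] (RatFunc ℂ) u / algebraMap ℂ[X] (RatFunc ℂ) v) (z : ℂ) :
    sphereMap η (z : OnePoint ℂ) = ratio (u.eval z) (v.eval z) := by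
  obtain ⟨c, hc, hu, hv'⟩ := exists_eq_C_mul_num_denom huv hv hη
  rw [hu, hv', eval_mul, eval_mul, eval_C, ratio_mul_left hc]
  rfl

lemma sphereMap_infty_of_eq_div {u v : ℂ[X]} (huv : IsCoprime u v) (hv : v ≠ 0) {η : RatFunc ℂ}
    (hη : η = algebraMap ℂ[X] (RatFunc ℂ) u / algebraMap ℂ[X] (RatFunc ℂ) v) :
    sphereMap η OnePoint.infty =
      ratio (u.coeff (max u.natDegree v.natDegree)) (v.coeff (max u.natDegree v.natDegree)) := by
  obtain ⟨c, hc, hu, hv'⟩ := exists_eq_C_mul_num_denom huv hv hη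
  rw [hu, hv', natDegree_C_mul hc, natDegree_C_mul hc, coeff_C_mul, coeff_C_mul, ratio_mul_left hc]
  rfl

/-- A rational map with real coefficients commutes with complex conjugation. -/
lemma sphereMap_J_of_hasRealCoefficients {η : RatFunc ℂ} (hη : HasRealCoefficients η)
    (p : OnePoint ℂ) : sphereMap η (J p) = J (sphereMap η p) := by
  obtain ⟨u, v, hv, hη⟩ := hη
  obtain ⟨u', v', hcop, hv', hη'⟩ : ∃ u' v' : ℝ[X], IsCoprime u' v' ∧ v' ≠ 0 ∧
      η = algebraMap ℂ[X] (RatFunc ℂ) (u'.map Complex.ofRealHom) /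
        algebraMap ℂ[X] (RatFunc ℂ) (v'.map Complex.ofRealHom) := by
    obtain ⟨u', hu'⟩ := EuclideanDomain.gcd_dvd_left u v
    obtain ⟨v', hv'⟩ := EuclideanDomain.gcd_dvd_right u v
    have hg : EuclideanDomain.gcd u v ≠ 0 := fun h => hv (EuclideanDomain.gcd_eq_zero_iff.1 h).2
    have hv0 : v' ≠ 0 := by
      rintro rfl
      exact hv (by rw [hv', mul_zero])
    refine ⟨u', v', ?_, hv0, ?_⟩
    · have := EuclideanDomain.gcd_eq_gcd_ab u v
      refine ⟨EuclideanDomain.gcdA u v, EuclideanDomain.gcdB u v, mul_left_cancel₀ hg ?_⟩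
      linear_combination -this - EuclideanDomain.gcdA u v * hu' - EuclideanDomain.gcdB u v * hv'
    · generalize EuclideanDomain.gcd u v = d at hu' hv' hg
      subst hu' hv'
      rw [hη, Polynomial.map_mul, Polynomial.map_mul, map_mul, map_mul, mul_div_mul_left]
      exact RatFunc.algebraMap_ne_zero (by rwa [Ne, Polynomial.map_eq_zero_iff
        Complex.ofRealHom.injective])
  have hcop' : IsCoprime (u'.map Complex.ofRealHom) (v'.map Complex.ofRealHom) :=
    hcop.map (Polynomial.mapRingHom Complex.ofRealHom)
  have hv0 : v'.map Complex.ofRealHom ≠ 0 := by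
    rwa [Ne, Polynomial.map_eq_zero_iff Complex.ofRealHom.injective]
  induction p using OnePoint.rec with
  | infty =>
    have hJ : J OnePoint.infty = OnePoint.infty := rfl
    rw [hJ, sphereMap_infty_of_eq_div hcop' hv0 hη', J_ratio]
    simp
  | coe z =>
    have hJ : J (z : OnePoint ℂ) = ((star z : ℂ) : OnePoint ℂ) := rfl
    have heval : ∀ w : ℝ[X], (w.map Complex.ofRealHom).eval (star z) =
        star ((w.map Complex.ofRealHom).eval z) := by
      intro w
      rw [eval_map, eval_map]
      have h := Polynomial.hom_eval₂ w Complex.ofRealHom (starRingEnd ℂ) z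
      rw [show (starRingEnd ℂ).comp Complex.ofRealHom = Complex.ofRealHom by ext; simp] at h
      exact h.symm
    rw [hJ, sphereMap_coe_of_eq_div hcop' hv0 hη', sphereMap_coe_of_eq_div hcop' hv0 hη', J_ratio,
      heval, heval]

/-! ### The map `z ψ(zⁿ)` in homogeneous coordinates -/

/-- The binary form `∑ a_k x^k y^{r-k}` of degree `r`, the homogenization of `numerator r a`. -/
def binaryForm (r : ℕ) (a : ℕ → ℂ) (x y : ℂ) : ℂ :=
  ∑ k ∈ Finset.range (r + 1), a k * x ^ k * y ^ (r - k)

lemma binaryForm_one_right (r : ℕ) (a : ℕ → ℂ) (x : ℂ) :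
    binaryForm r a x 1 = (numerator r a).eval x := by
  simp [binaryForm, numerator, eval_finsetSum]

lemma binaryForm_zero_right (r : ℕ) (a : ℕ → ℂ) (x : ℂ) :
    binaryForm r a x 0 = a r * x ^ r := by
  unfold binaryForm
  rw [Finset.sum_range_succ, Finset.sum_eq_zero]
  · simp
  · intro k hk
    have : r - k ≠ 0 := by have := Finset.mem_range.1 hk; lia
    simp [this]

lemma binaryForm_mul_mul (r : ℕ) (a : ℕ → ℂ) (c x y : ℂ) :
    binaryForm r a (c * x) (c * y) = c ^ r * binaryForm r a x y := by
  unfold binaryForm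
  rw [Finset.mul_sum]
  refine Finset.sum_congr rfl fun k hk => ?_
  have hk : k + (r - k) = r := by have := Finset.mem_range.1 hk; lia
  calc _ = a k * x ^ k * y ^ (r - k) * (c ^ k * c ^ (r - k)) := by ring
    _ = _ := by rw [← pow_add, hk]; ring

lemma binaryForm_eq_eval (r : ℕ) (a : ℕ → ℂ) (x : ℂ) {y : ℂ} (hy : y ≠ 0) :
    binaryForm r a x y = y ^ r * (numerator r a).eval (x / y) := by
  rw [← binaryForm_one_right, ← binaryForm_mul_mul, mul_div_cancel₀ _ hy, mul_one]

lemma continuous_binaryForm_left (r : ℕ) (a : ℕ → ℂ) (y : ℂ) :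
    Continuous fun x => binaryForm r a x y := by
  unfold binaryForm
  fun_prop

lemma continuous_binaryForm_right (r : ℕ) (a : ℕ → ℂ) (x : ℂ) :
    Continuous fun y => binaryForm r a x y := by
  unfold binaryForm
  fun_prop

lemma coeff_numerator {r k : ℕ} (hk : k ≤ r) (a : ℕ → ℂ) : (numerator r a).coeff k = a k := by
  unfold numerator
  simp only [finsetSum_coeff, coeff_C_mul, coeff_X_pow, mul_ite, mul_one, mul_zero]
  rw [Finset.sum_ite_eq]
  simp [Nat.lt_succ_of_le hk]

lemma natDegree_numerator_le (r : ℕ) (a : ℕ → ℂ) : (numerator r a).natDegree ≤ r := by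
  unfold numerator
  refine natDegree_sum_le_of_forall_le _ _ fun k hk => ?_
  exact (natDegree_C_mul_X_pow_le _ _).trans (by have := Finset.mem_range.1 hk; lia)

lemma natDegree_numerator {r : ℕ} {a : ℕ → ℂ} (ha : a r ≠ 0) : (numerator r a).natDegree = r :=
  natDegree_eq_of_le_of_coeff_ne_zero (natDegree_numerator_le r a)
    (by rwa [coeff_numerator le_rfl])

/-- The hypotheses under which `z ψ(zⁿ)`, with `ψ = (∑ a_k z^k) / (∑ b_k z^k)`, is a rational map
of degree `n r + 1` in lowest terms that fixes `0` and `∞`. -/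
structure IsTwisted (n r : ℕ) (a b : ℕ → ℂ) (φ : RatFunc ℂ) : Prop where
  n_ne_zero : n ≠ 0
  lead_ne_zero : a r ≠ 0
  const_ne_zero : b 0 ≠ 0
  isCoprime : IsCoprime (numerator r a) (numerator r b)
  eq : φ = RatFunc.X * RatFunc.eval RatFunc.C (RatFunc.X ^ n)
    (algebraMap ℂ[X] (RatFunc ℂ) (numerator r a) / algebraMap ℂ[X] (RatFunc ℂ) (numerator r b))

section

variable {n r : ℕ} {a b : ℕ → ℂ} {φ : RatFunc ℂ}

namespace IsTwisted

lemma numerator_denom_ne_zero (h : IsTwisted n r a b φ) : numerator r b ≠ 0 := fun h0 => by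
  have := coeff_numerator (Nat.zero_le r) b
  rw [h0, coeff_zero] at this
  exact h.const_ne_zero this.symm

lemma eq_div (h : IsTwisted n r a b φ) :
    φ = algebraMap ℂ[X] (RatFunc ℂ) (X * expand ℂ n (numerator r a)) /
      algebraMap ℂ[X] (RatFunc ℂ) (expand ℂ n (numerator r b)) := by
  obtain ⟨ψ, hψ⟩ : ∃ ψ, ψ = algebraMap ℂ[X] (RatFunc ℂ) (numerator r a) /
    algebraMap ℂ[X] (RatFunc ℂ) (numerator r b) := ⟨_, rfl⟩
  obtain ⟨c, hc, hu, hv⟩ := exists_eq_C_mul_num_denom h.isCoprime h.numerator_denom_ne_zero hψ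
  have heval : ∀ w : ℂ[X], w.eval₂ RatFunc.C (RatFunc.X ^ n) =
      algebraMap ℂ[X] (RatFunc ℂ) (expand ℂ n w) := by
    intro w
    rw [expand_eq_sum, eval₂_eq_sum, Polynomial.sum, Polynomial.sum, map_sum]
    refine Finset.sum_congr rfl fun k _ => ?_
    rw [map_mul, map_pow, map_pow, RatFunc.algebraMap_C, RatFunc.algebraMap_X]
  rw [h.eq, ← hψ, RatFunc.eval, heval, heval, hu, hv, map_mul (expand ℂ n),
    map_mul (expand ℂ n), expand_C, map_mul, map_mul, map_mul, RatFunc.algebraMap_X]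
  have : algebraMap ℂ[X] (RatFunc ℂ) (C c) ≠ 0 := RatFunc.algebraMap_ne_zero (by simpa using hc)
  rw [mul_left_comm, mul_div_mul_left _ _ this, mul_div_assoc]

lemma isCoprime_expand (h : IsTwisted n r a b φ) :
    IsCoprime (X * expand ℂ n (numerator r a)) (expand ℂ n (numerator r b)) := by
  refine IsCoprime.mul_left ?_ (h.isCoprime.map (expand ℂ n : ℂ[X] →+* ℂ[X]))
  rw [Polynomial.irreducible_X.coprime_iff_not_dvd, X_dvd_iff, coeff_zero_eq_eval_zero, expand_eval,
    zero_pow h.n_ne_zero, ← coeff_zero_eq_eval_zero, coeff_numerator (Nat.zero_le r)]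
  exact h.const_ne_zero

lemma expand_denom_ne_zero (h : IsTwisted n r a b φ) : expand ℂ n (numerator r b) ≠ 0 := by
  rw [Ne, expand_eq_zero (Nat.pos_of_ne_zero h.n_ne_zero)]
  exact h.numerator_denom_ne_zero

lemma pair_ne_zero (h : IsTwisted n r a b φ) {x y : ℂ} (hxy : x ≠ 0 ∨ y ≠ 0) :
    x * binaryForm r a (x ^ n) (y ^ n) ≠ 0 ∨ y * binaryForm r b (x ^ n) (y ^ n) ≠ 0 := by
  by_cases hy : y = 0
  · have hx : x ≠ 0 := by tauto
    left
    rw [hy, zero_pow h.n_ne_zero, binaryForm_zero_right]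
    simp [hx, h.lead_ne_zero]
  · by_cases hx : x = 0
    · right
      rw [hx, zero_pow h.n_ne_zero, binaryForm_eq_eval _ _ _ (pow_ne_zero n hy), zero_div,
        ← coeff_zero_eq_eval_zero, coeff_numerator (Nat.zero_le r)]
      simp [hy, h.const_ne_zero]
    · rw [binaryForm_eq_eval _ _ _ (pow_ne_zero n hy), binaryForm_eq_eval _ _ _ (pow_ne_zero n hy)]
      by_contra! hc
      obtain ⟨s, t, hst⟩ := h.isCoprime
      have := congrArg (Polynomial.eval (x ^ n / y ^ n)) hst
      simp [hx, hy] at hc this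
      simp [hc] at this

/-- The map `z ψ(zⁿ)` in homogeneous coordinates. -/
lemma sphereMap_ratio (h : IsTwisted n r a b φ) {x y : ℂ} (hxy : x ≠ 0 ∨ y ≠ 0) :
    sphereMap φ (ratio x y) =
      ratio (x * binaryForm r a (x ^ n) (y ^ n)) (y * binaryForm r b (x ^ n) (y ^ n)) := by
  by_cases hy : y = 0
  · subst hy
    have hdeg : (X * expand ℂ n (numerator r a)).natDegree = r * n + 1 := by
      have : expand ℂ n (numerator r a) ≠ 0 := by
        rw [Ne, expand_eq_zero (Nat.pos_of_ne_zero h.n_ne_zero)]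
        intro h0
        have := coeff_numerator le_rfl a (r := r)
        rw [h0, coeff_zero] at this
        exact h.lead_ne_zero this.symm
      rw [natDegree_X_mul this, natDegree_expand, natDegree_numerator h.lead_ne_zero]
    have hdeg' : (expand ℂ n (numerator r b)).natDegree < r * n + 1 := by
      rw [natDegree_expand]
      exact Nat.lt_succ_of_le (Nat.mul_le_mul_right n (natDegree_numerator_le r b))
    rw [ratio_zero_right, zero_mul, ratio_zero_right,
      sphereMap_infty_of_eq_div h.isCoprime_expand h.expand_denom_ne_zero h.eq_div, hdeg,
      max_eq_left hdeg'.le, coeff_eq_zero_of_natDegree_lt hdeg', ratio_zero_right]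
  · have hr : ratio x y = ((x / y : ℂ) : OnePoint ℂ) := by simp [ratio, hy]
    have hyn : y ^ n ≠ 0 := pow_ne_zero n hy
    rw [hr, sphereMap_coe_of_eq_div h.isCoprime_expand h.expand_denom_ne_zero h.eq_div,
      binaryForm_eq_eval _ _ _ hyn, binaryForm_eq_eval _ _ _ hyn, eval_mul, eval_X, expand_eval,
      expand_eval, div_pow, ← ratio_mul_left (mul_ne_zero hy (pow_ne_zero r hyn))]
    congr 1
    · field_simp
    · ring

lemma finite_fixedPoints (h : IsTwisted n r a b φ) (hr : r ≠ 0) :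
    {p | sphereMap φ p = p}.Finite := by
  have hne : numerator r a ≠ numerator r b := by
    intro he
    have hu := h.isCoprime
    rw [← he, isCoprime_self] at hu
    have := natDegree_eq_zero_of_isUnit hu
    rw [natDegree_numerator h.lead_ne_zero] at this
    exact hr this
  have hne' : X * (expand ℂ n (numerator r a) - expand ℂ n (numerator r b)) ≠ 0 := by
    refine mul_ne_zero X_ne_zero (sub_ne_zero.2 fun he => hne ?_)
    exact expand_injective (Nat.pos_of_ne_zero h.n_ne_zero) he
  refine (((Polynomial.finite_setOfPred_isRoot hne').image ((↑) : ℂ → OnePoint ℂ)).insert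
    OnePoint.infty).subset fun p hp => ?_
  induction p using OnePoint.rec with
  | infty => simp
  | coe z =>
    right
    refine ⟨z, ?_, rfl⟩
    rw [Set.mem_ofPred_eq, ← ratio_one_right, h.sphereMap_ratio (by simp),
      ratio_eq_ratio_iff (h.pair_ne_zero (by simp)) (by simp)] at hp
    simp only [one_pow, binaryForm_one_right, one_mul, mul_one] at hp
    simp only [Set.mem_ofPred_eq, IsRoot.def, eval_mul, eval_X, eval_sub, expand_eval]
    linear_combination hp

end IsTwisted

lemma comp_comp_inv_eq_iff {T : Equiv.Perm (OnePoint ℂ)} {f : OnePoint ℂ → OnePoint ℂ} :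
    ⇑T ∘ f ∘ ⇑T⁻¹ = f ↔ ∀ p, T (f p) = f (T p) := by
  constructor
  · intro h p
    simpa using congrFun h (T p)
  · intro h
    ext p
    simp [h]

lemma toMoebius_mem_Aut_iff {g : GL (Fin 2) ℂ} :
    toMoebius g ∈ Aut φ ↔ ∀ p, g • sphereMap φ p = sphereMap φ (g • p) := by
  have : toMoebius g ∈ Aut φ ↔
    toMoebius g ∈ moebius ∧ ⇑(toMoebius g) ∘ sphereMap φ ∘ ⇑(toMoebius g)⁻¹ = sphereMap φ := Iff.rfl
  rw [this, comp_comp_inv_eq_iff]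
  exact and_iff_right ⟨g, rfl⟩

/-! ### The automorphism group -/

namespace IsTwisted

lemma rotation_mem_Aut (h : IsTwisted n r a b φ) : rotation n ∈ Aut φ := by
  rw [rotation_eq, toMoebius_mem_Aut_iff]
  intro p
  obtain ⟨x, y, hxy, rfl⟩ := exists_eq_ratio p
  have hxy' : omega n * x ≠ 0 ∨ y ≠ 0 := by simpa [omega_ne_zero] using hxy
  rw [h.sphereMap_ratio hxy, scaling_smul_ratio _ hxy, h.sphereMap_ratio hxy',
    scaling_smul_ratio _ (h.pair_ne_zero hxy), mul_pow,
    (isPrimitiveRoot_omega h.n_ne_zero).pow_eq_one, one_mul, mul_assoc]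

/-- If `z ↦ u z` is an automorphism then `ψ(uⁿ w) = ψ(w)`; since `ψ` is in lowest terms,
its numerator is invariant as well, and the coefficient of `w` shows `uⁿ = 1`. -/
lemma pow_eq_one_of_scaling_mem_Aut (h : IsTwisted n r a b φ) (hr : r ≠ 0) (h0 : a 0 ≠ 0)
    (h1 : a 1 ≠ 0) {u : ℂ} (hu : u ≠ 0) (hmem : toMoebius (scaling u hu) ∈ Aut φ) :
    u ^ n = 1 := by
  rw [toMoebius_mem_Aut_iff] at hmem
  set P := numerator r a
  set Q := numerator r b
  have hpoly : P * Q.comp (C (u ^ n) * X) = P.comp (C (u ^ n) * X) * Q := by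
    refine Polynomial.funext fun w => ?_
    rcases eq_or_ne w 0 with rfl | hw
    · simp
    obtain ⟨x, rfl⟩ := IsAlgClosed.exists_pow_nat_eq w (Nat.pos_of_ne_zero h.n_ne_zero)
    have hx : x ≠ 0 := by
      rintro rfl
      exact hw (zero_pow h.n_ne_zero)
    have key := hmem (ratio x 1)
    have hp := h.pair_ne_zero (x := x) (y := 1) (by simp)
    rw [scaling_smul_ratio _ (by simp), h.sphereMap_ratio (by simp), h.sphereMap_ratio (by simp),
      scaling_smul_ratio _ hp, ratio_eq_ratio_iff (by simpa [hu] using hp)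
        (h.pair_ne_zero (by simp))] at key
    simp only [one_pow, binaryForm_one_right, one_mul, mul_pow] at key
    simp only [eval_mul, eval_comp, eval_C, eval_X]
    refine mul_left_cancel₀ (mul_ne_zero hu hx) ?_
    linear_combination key
  have hdvd : P ∣ P.comp (C (u ^ n) * X) :=
    h.isCoprime.dvd_of_dvd_mul_right ⟨_, hpoly.symm⟩
  have hun : u ^ n ≠ 0 := pow_ne_zero n hu
  obtain ⟨s, hs⟩ := hdvd
  have hP : P.natDegree = r := natDegree_numerator h.lead_ne_zero
  have hP0 : P ≠ 0 := by
    rintro h0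
    rw [h0, natDegree_zero] at hP
    exact hr hP.symm
  have hdeg : (P.comp (C (u ^ n) * X)).natDegree = P.natDegree := by
    rw [natDegree_comp, natDegree_C_mul_X _ hun, mul_one]
  have hs0 : s ≠ 0 := by
    rintro rfl
    rw [hs, mul_zero, natDegree_zero, hP] at hdeg
    exact hr hdeg.symm
  rw [hs, natDegree_mul hP0 hs0] at hdeg
  obtain ⟨c, rfl⟩ : ∃ c, s = C c := ⟨_, eq_C_of_natDegree_eq_zero (by lia)⟩
  have c0 := congrArg (fun p => coeff p 0) hs
  have c1 := congrArg (fun p => coeff p 1) hs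
  simp only [comp_C_mul_X_coeff, coeff_mul_C, P, coeff_numerator (Nat.zero_le r),
    coeff_numerator (Nat.one_le_iff_ne_zero.2 hr), pow_zero, mul_one, pow_one] at c0 c1
  have hc : c = 1 := by
    refine mul_left_cancel₀ h0 ?_
    rw [← c0, mul_one]
  rw [hc, mul_one] at c1
  exact mul_left_cancel₀ h1 (by rw [c1, mul_one])

/-- An automorphism `z ↦ u / z` would make the multipliers of `φ` at the fixed points `0` and `∞`
equal, that is, `a 0 / b 0 = b r / a r`. -/
lemma inversion_notMem_Aut (h : IsTwisted n r a b φ) (hne : a 0 * a r ≠ b 0 * b r)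
    {u : ℂ} (hu : u ≠ 0) : toMoebius (inversion u hu) ∉ Aut φ := by
  intro hmem
  rw [toMoebius_mem_Aut_iff] at hmem
  have hform : ∀ w ≠ 0, binaryForm r b w 1 * binaryForm r b (u ^ n) w =
      binaryForm r a (u ^ n) w * binaryForm r a w 1 := by
    intro w hw
    obtain ⟨x, rfl⟩ := IsAlgClosed.exists_pow_nat_eq w (Nat.pos_of_ne_zero h.n_ne_zero)
    have hx : x ≠ 0 := by
      rintro rfl
      exact hw (zero_pow h.n_ne_zero)
    have key := hmem (ratio x 1)
    have hp := h.pair_ne_zero (x := x) (y := 1) (by simp)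
    rw [inversion_smul_ratio _ (by simp), h.sphereMap_ratio (by simp),
      h.sphereMap_ratio (by simp [hu]), inversion_smul_ratio _ hp,
      ratio_eq_ratio_iff (by simpa [hu] using hp.symm) (h.pair_ne_zero (by simp [hu]))] at key
    simp only [one_pow, one_mul, mul_one] at key
    refine mul_left_cancel₀ (mul_ne_zero hu hx) ?_
    linear_combination key
  -- The identity extends to `w = 0` by continuity.
  have hext : (fun w => binaryForm r b w 1 * binaryForm r b (u ^ n) w) =
      fun w => binaryForm r a (u ^ n) w * binaryForm r a w 1 := by
    refine Continuous.ext_on (dense_compl_singleton (0 : ℂ)) ?_ ?_ fun w hw => hform w hw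
    · exact (continuous_binaryForm_left r b 1).mul (continuous_binaryForm_right r b _)
    · exact (continuous_binaryForm_right r a _).mul (continuous_binaryForm_left r a 1)
  have hzero := congrFun hext 0
  simp only [binaryForm_one_right, binaryForm_zero_right, ← coeff_zero_eq_eval_zero,
    coeff_numerator (Nat.zero_le r)] at hzero
  have hun : (u ^ n) ^ r ≠ 0 := pow_ne_zero r (pow_ne_zero n hu)
  exact hne (mul_right_cancel₀ hun (by linear_combination -hzero))

end IsTwisted

/-- A group of Möbius transformations that preserves a finite set containing `0`, `∞` and a third
point is finite. -/
lemma finite_of_mapsTo_finite {G : Subgroup (Equiv.Perm (OnePoint ℂ))} (hG : G ≤ moebius)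
    {F : Set (OnePoint ℂ)} (hF : F.Finite) (hGF : ∀ g ∈ G, Set.MapsTo g F F)
    (h0 : ratio 0 1 ∈ F) (hinf : ratio 1 0 ∈ F) {x y : ℂ} (hx : x ≠ 0) (hy : y ≠ 0)
    (hxy : ratio x y ∈ F) : Finite G := by
  have := hF.to_subtype
  refine Finite.of_injective (fun g : G => (hGF g.1 g.2).restrict) ?_
  intro g₁ g₂ hg
  have heq : ∀ p ∈ F, g₁.1 p = g₂.1 p := fun p hp =>
    congrArg Subtype.val (congrFun hg ⟨p, hp⟩)
  obtain ⟨s, hs⟩ := hG (G.mul_mem (G.inv_mem g₂.2) g₁.2)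
  have hfix : ∀ p ∈ F, s • p = p := by
    intro p hp
    have : s • p = (g₂.1⁻¹ * g₁.1) p := DFunLike.congr_fun hs p
    rw [this, Equiv.Perm.mul_apply, heq p hp]
    simp
  have hs1 : toMoebius s = 1 := by
    have e0 := hfix _ h0
    have e1 := hfix _ hinf
    have e2 := hfix _ hxy
    have n0 := linear_ne_zero s (x := 0) (y := 1) (by simp)
    have n1 := linear_ne_zero s (x := 1) (y := 0) (by simp)
    have n2 := linear_ne_zero s (x := x) (y := y) (by simp [hx])
    rw [smul_ratio _ (by simp), ratio_eq_ratio_iff n0 (by simp)] at e0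
    rw [smul_ratio _ (by simp), ratio_eq_ratio_iff n1 (by simp)] at e1
    rw [smul_ratio _ (by simp [hx]), ratio_eq_ratio_iff n2 (by simp [hx])] at e2
    simp only [mul_zero, mul_one, zero_add, zero_mul, add_zero, one_mul] at e0 e1
    rw [toMoebius_eq_one_iff]
    refine ⟨e0, e1.symm, mul_right_cancel₀ (mul_ne_zero hx hy) ?_⟩
    rw [e0, ← e1] at e2
    linear_combination e2
  have : g₂.1⁻¹ * g₁.1 = 1 := hs.symm.trans hs1
  exact Subtype.ext (inv_mul_eq_one.1 this).symm

namespace IsTwisted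

lemma diagonal_or_antidiagonal (h : IsTwisted n r a b φ) (hn : 6 ≤ n) (hr : r ≠ 0)
    {g : GL (Fin 2) ℂ} (hg : toMoebius g ∈ Aut φ) :
    (g 0 1 = 0 ∧ g 1 0 = 0) ∨ (g 0 0 = 0 ∧ g 1 1 = 0) := by
  have hD := g.det_ne_zero
  rw [Matrix.det_fin_two] at hD
  set F := {p | sphereMap φ p = p}
  have hmaps : ∀ T ∈ Aut φ, Set.MapsTo T F F := by
    intro T hT p hp
    have : T (sphereMap φ p) = sphereMap φ (T p) := comp_comp_inv_eq_iff.1 hT.2 p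
    rw [show sphereMap φ p = p from hp] at this
    exact this.symm
  have h0 : ratio 0 1 ∈ F := by
    change sphereMap φ _ = _
    rw [h.sphereMap_ratio (by simp), ratio_eq_ratio_iff (h.pair_ne_zero (by simp)) (by simp)]
    simp
  have hinf : ratio 1 0 ∈ F := by
    change sphereMap φ _ = _
    rw [h.sphereMap_ratio (by simp), ratio_eq_ratio_iff (h.pair_ne_zero (by simp)) (by simp)]
    simp
  -- A third fixed point of `φ` makes the automorphism group finite.
  have hthird : ∀ x y : ℂ, x ≠ 0 → y ≠ 0 → ratio x y ∈ F →
      (g 0 1 = 0 ∧ g 1 0 = 0) ∨ (g 0 0 = 0 ∧ g 1 1 = 0) := by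
    intro x y hx hy hxy
    have hfin : Finite (Aut φ) :=
      finite_of_mapsTo_finite (fun T hT => hT.1) (h.finite_fixedPoints hr) hmaps h0 hinf hx hy hxy
    refine diagonal_or_antidiagonal_of_finite hn (Γ := (Aut φ).comap toMoebius) ?_ ?_ hg
    · exact Finite.of_injective _ (Subgroup.inclusion_injective (Subgroup.map_comap_le _ _))
    · rw [Subgroup.mem_comap, ← rotation_eq]
      exact h.rotation_mem_Aut
  have m0 : g • ratio 0 1 ∈ F := hmaps _ hg h0
  have m1 : g • ratio 1 0 ∈ F := hmaps _ hg hinf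
  rw [smul_ratio _ (by simp)] at m0 m1
  simp only [mul_zero, mul_one, zero_add, add_zero] at m0 m1
  by_cases hb : g 0 1 = 0
  · by_cases hc : g 1 0 = 0
    · exact Or.inl ⟨hb, hc⟩
    · refine hthird _ _ (fun ha => hD ?_) hc m1
      simp [ha, hb]
  · by_cases hd : g 1 1 = 0
    · by_cases ha : g 0 0 = 0
      · exact Or.inr ⟨ha, hd⟩
      · refine hthird _ _ ha (fun hc => hD ?_) m1
        simp [hc, hd]
    · exact hthird _ _ hb hd m0

theorem Aut_eq (h : IsTwisted n r a b φ) (hn : 6 ≤ n) (hr : r ≠ 0) (h0 : a 0 ≠ 0) (h1 : a 1 ≠ 0)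
    (hne : a 0 * a r ≠ b 0 * b r) : Aut φ = Subgroup.zpowers (rotation n) := by
  refine le_antisymm (fun T hT => ?_) (by simpa using h.rotation_mem_Aut)
  obtain ⟨g, rfl⟩ := hT.1
  have hD := g.det_ne_zero
  rw [Matrix.det_fin_two] at hD
  rcases h.diagonal_or_antidiagonal hn hr hT with ⟨hb, hc⟩ | ⟨ha, hd⟩
  · have ha : g 0 0 ≠ 0 := fun ha => hD (by simp [ha, hb])
    have hd : g 1 1 ≠ 0 := fun hd => hD (by simp [hd, hb])
    have hu : g 0 0 / g 1 1 ≠ 0 := div_ne_zero ha hd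
    have hg : ∀ x y : ℂ, (x ≠ 0 ∨ y ≠ 0) → toMoebius g (ratio x y) =
        ratio (g 0 0 / g 1 1 * x) y := by
      intro x y hxy
      rw [MulAction.toPermHom_apply, MulAction.toPerm_apply, smul_ratio _ hxy, hb, hc, zero_mul,
        zero_mul, add_zero, zero_add, ← ratio_mul_left hd (g 0 0 / g 1 1 * x)]
      congr 1
      field_simp
    have hgs : toMoebius g = toMoebius (scaling _ hu) := by
      ext p
      obtain ⟨x, y, hxy, rfl⟩ := exists_eq_ratio p
      rw [hg x y hxy]
      exact (scaling_smul_ratio hu hxy).symm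
    have hpow := h.pow_eq_one_of_scaling_mem_Aut hr h0 h1 hu (hgs ▸ hT)
    have : NeZero n := ⟨h.n_ne_zero⟩
    obtain ⟨k, -, hk⟩ := (isPrimitiveRoot_omega h.n_ne_zero).eq_pow_of_pow_eq_one hpow
    refine ⟨k, ?_⟩
    simp only [zpow_natCast]
    ext p
    obtain ⟨x, y, hxy, rfl⟩ := exists_eq_ratio p
    rw [rotation_pow_ratio n k hxy, hk, ← hg x y hxy]
  · exfalso
    have hb : g 0 1 ≠ 0 := fun hb => hD (by simp [ha, hb])
    have hc : g 1 0 ≠ 0 := fun hc => hD (by simp [hd, hc])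
    have hu : g 0 1 / g 1 0 ≠ 0 := div_ne_zero hb hc
    refine h.inversion_notMem_Aut hne hu ?_
    convert hT using 1
    ext p
    obtain ⟨x, y, hxy, rfl⟩ := exists_eq_ratio p
    rw [MulAction.toPermHom_apply, MulAction.toPerm_apply, inversion_smul_ratio _ hxy,
      MulAction.toPermHom_apply, MulAction.toPerm_apply, smul_ratio _ hxy, ha, hd, zero_mul,
      zero_mul, add_zero, zero_add, ← ratio_mul_left hc (g 0 1 / g 1 0 * y)]
    congr 1
    field_simp

end IsTwisted

end

/-! ### Pseudo-reality -/

/-- The coefficients `(-1)^k e^{iθ} conj(a_{r-k})` of `denominator r θ a`. -/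
noncomputable def dualCoeff (r : ℕ) (θ : ℝ) (a : ℕ → ℂ) (k : ℕ) : ℂ :=
  (-1) ^ k * Complex.exp (θ * Complex.I) * star (a (r - k))

lemma denominator_eq (r : ℕ) (θ : ℝ) (a : ℕ → ℂ) :
    denominator r θ a = numerator r (dualCoeff r θ a) := rfl

lemma exp_mul_star_exp (θ : ℝ) :
    Complex.exp (θ * Complex.I) * star (Complex.exp (θ * Complex.I)) = 1 := by
  rw [Complex.star_def, ← Complex.exp_conj, ← Complex.exp_add]
  simp

/-- The substitution `(x, y) ↦ (-ȳ, x̄)`, which represents `w ↦ -1 / w̄`, carries the form of the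
denominator to the conjugate of the form of the numerator. -/
lemma binaryForm_dualCoeff_neg_star (r : ℕ) (θ : ℝ) (a : ℕ → ℂ) (x y : ℂ) :
    binaryForm r (dualCoeff r θ a) (-star y) (star x) =
      Complex.exp (θ * Complex.I) * star (binaryForm r a x y) := by
  unfold binaryForm dualCoeff
  rw [← Finset.sum_range_reflect (n := r + 1), star_sum, Finset.mul_sum]
  refine Finset.sum_congr rfl fun k hk => ?_
  have hk : k ≤ r := Nat.lt_succ_iff.1 (Finset.mem_range.1 hk)
  rw [show r + 1 - 1 - k = r - k by lia, Nat.sub_sub_self hk, neg_pow]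
  have h1 : ((-1 : ℂ) ^ (r - k)) * (-1) ^ (r - k) = 1 := by rw [← mul_pow]; simp
  simp only [star_mul', star_pow]
  linear_combination
    Complex.exp (θ * Complex.I) * star (a k) * star y ^ (r - k) * star x ^ k * h1

/-- The companion of `binaryForm_dualCoeff_neg_star` with the two forms exchanged. It is obtained by
applying that identity twice: `(x, y) ↦ (-ȳ, x̄)` has square `-1`, which acts trivially on forms of
even degree. -/
lemma binaryForm_neg_star {r : ℕ} (hr : Even r) (θ : ℝ) (a : ℕ → ℂ) (x y : ℂ) :
    binaryForm r a (-star y) (star x) =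
      Complex.exp (θ * Complex.I) * star (binaryForm r (dualCoeff r θ a) x y) := by
  have h := binaryForm_dualCoeff_neg_star r θ a (-star y) (star x)
  have hneg : binaryForm r (dualCoeff r θ a) (-star (star x)) (star (-star y)) =
      binaryForm r (dualCoeff r θ a) x y := by
    have h2 := binaryForm_mul_mul r (dualCoeff r θ a) (-1) x y
    rw [hr.neg_one_pow, one_mul] at h2
    rw [← h2]
    simp
  rw [hneg] at h
  rw [h, star_mul', star_star]
  linear_combination (-binaryForm r a (-star y) (star x)) * exp_mul_star_exp θ

lemma exists_pow_eq_neg_one {n : ℕ} (hn : n ≠ 0) : ∃ c : ℂ, c ≠ 0 ∧ c ^ n = -1 := by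
  obtain ⟨c, hc⟩ := IsAlgClosed.exists_pow_nat_eq (-1 : ℂ) (Nat.pos_of_ne_zero hn)
  refine ⟨c, ?_, hc⟩
  rintro rfl
  simp [hn] at hc

lemma isExtendedMoebius_inversion {c : ℂ} (hc : c ≠ 0) :
    IsExtendedMoebius (toMoebius (inversion c hc) * J) := ⟨_, ⟨_, rfl⟩, rfl⟩

lemma inversion_mul_J_ratio {c : ℂ} (hc : c ≠ 0) {x y : ℂ} (h : x ≠ 0 ∨ y ≠ 0) :
    (toMoebius (inversion c hc) * J) (ratio x y) = ratio (c * star y) (star x) := by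
  rw [Equiv.Perm.mul_apply, J_ratio, MulAction.toPermHom_apply, MulAction.toPerm_apply,
    inversion_smul_ratio hc (by simpa using h)]

/-- The map `z ↦ c / z̄` with `cⁿ = -1` is an antiholomorphic automorphism. -/
lemma IsTwisted.isAntiholomorphicAut {n r : ℕ} (hr : Even r) {θ : ℝ} {a : ℕ → ℂ} {φ : RatFunc ℂ}
    (h : IsTwisted n r a (dualCoeff r θ a) φ) {c : ℂ} (hc : c ≠ 0) (hcn : c ^ n = -1) :
    IsAntiholomorphicAut φ (toMoebius (inversion c hc) * J) := by
  refine ⟨isExtendedMoebius_inversion hc, comp_comp_inv_eq_iff.2 fun p => ?_⟩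
  obtain ⟨x, y, hxy, rfl⟩ := exists_eq_ratio p
  have hxy' : c * star y ≠ 0 ∨ star x ≠ 0 := by simpa [hc] using hxy.symm
  rw [h.sphereMap_ratio hxy, inversion_mul_J_ratio hc hxy,
    inversion_mul_J_ratio hc (h.pair_ne_zero hxy), h.sphereMap_ratio hxy',
    show (c * star y) ^ n = -star (y ^ n) by rw [mul_pow, hcn, star_pow, neg_one_mul],
    ← star_pow, binaryForm_neg_star hr θ, binaryForm_dualCoeff_neg_star,
    ← ratio_mul_left (Complex.exp_ne_zero (θ * Complex.I)), star_mul', star_mul']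
  congr 1 <;> ring

/-- Conjugating a real map back gives an antiholomorphic automorphism `T⁻¹ J T` with a fixed point.
Composed with `z ↦ c / z̄` it is one of the rotations, so `c ȳ y = ω^k x x̄` at the fixed point
`x / y`; the `n`-th powers of the two sides have opposite signs. -/
lemma not_isReal_of_isAntiholomorphicAut {n : ℕ} (hn : n ≠ 0) {φ : RatFunc ℂ}
    (hAut : Aut φ = Subgroup.zpowers (rotation n)) {c : ℂ} (hc : c ≠ 0) (hcn : c ^ n = -1)
    (hQ : IsAntiholomorphicAut φ (toMoebius (inversion c hc) * J)) : ¬ IsReal φ := by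
  rintro ⟨η, hη, T, hT, hTη⟩
  set U := toMoebius (inversion c hc)
  have hφT : ∀ p, T (sphereMap φ p) = sphereMap η (T p) := fun p => by
    rw [hTη]
    simp
  have hR : ∀ p, (T⁻¹ * J * T) (sphereMap φ p) = sphereMap φ ((T⁻¹ * J * T) p) := by
    intro p
    apply T.injective
    rw [hφT]
    have hcancel : ∀ q, T ((T⁻¹ * J * T) q) = J (T q) := fun q => by simp
    rw [hcancel, hcancel, hφT, sphereMap_J_of_hasRealCoefficients hη]
  have hmem : U * J * (T⁻¹ * J * T) ∈ Aut φ := by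
    refine ⟨?_, comp_comp_inv_eq_iff.2 fun p => ?_⟩
    · rw [show U * J * (T⁻¹ * J * T) = U * (J * T⁻¹ * J) * T by group]
      exact moebius.mul_mem (moebius.mul_mem ⟨_, rfl⟩ (J_mul_mul_J_mem (moebius.inv_mem hT))) hT
    · rw [Equiv.Perm.mul_apply, hR, comp_comp_inv_eq_iff.1 hQ.2, ← Equiv.Perm.mul_apply]
  rw [hAut] at hmem
  have hfin : IsOfFinOrder (rotation n) := by
    rw [← orderOf_pos_iff, orderOf_rotation hn]
    exact Nat.pos_of_ne_zero hn
  obtain ⟨k, hk⟩ := hfin.mem_powers_iff_mem_zpowers.2 hmem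
  simp only at hk
  obtain ⟨x, y, hxy, hp⟩ := exists_eq_ratio (T⁻¹ (ratio 0 1))
  have hfix : (T⁻¹ * J * T) (ratio x y) = ratio x y := by
    have hJ : J (ratio 0 1) = ratio 0 1 := by rw [J_ratio, star_zero, star_one]
    have hTT : T (T⁻¹ (ratio 0 1)) = ratio 0 1 := by rw [← Equiv.Perm.mul_apply]; simp
    rw [← hp, Equiv.Perm.mul_apply, Equiv.Perm.mul_apply, hTT, hJ]
  have hval := DFunLike.congr_fun hk (ratio x y)
  rw [Equiv.Perm.mul_apply (U * J), hfix, inversion_mul_J_ratio hc hxy, rotation_pow_ratio n k hxy,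
    ratio_eq_ratio_iff (by simpa [omega_ne_zero] using hxy)
      (by simpa [hc] using hxy.symm)] at hval
  have hpow := congrArg (· ^ n) hval
  simp only [mul_pow, ← pow_mul, hcn] at hpow
  rw [mul_comm k n, pow_mul (omega n), (isPrimitiveRoot_omega hn).pow_eq_one, one_pow, one_mul,
    ← mul_pow, mul_assoc, ← mul_pow, Complex.star_def, Complex.mul_conj,
    mul_comm (starRingEnd ℂ y), Complex.mul_conj] at hpow
  have hreal : Complex.normSq x ^ n = -Complex.normSq y ^ n := by
    have : ((Complex.normSq x ^ n : ℝ) : ℂ) = ((-Complex.normSq y ^ n : ℝ) : ℂ) := by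
      push_cast
      linear_combination hpow
    exact_mod_cast this
  have hx := pow_nonneg (Complex.normSq_nonneg x) n
  have hy := pow_nonneg (Complex.normSq_nonneg y) n
  have hx0 : x = 0 := by
    have : Complex.normSq x ^ n = 0 := by linarith
    simpa [hn] using this
  have hy0 : y = 0 := by
    have : Complex.normSq y ^ n = 0 := by linarith
    simpa [hn] using this
  tauto

end PseudoRealMaps

theorem theorem3p5 (n r : ℕ) (hn : 6 ≤ n) (hr : 2 ≤ r) (hr_even : Even r) (θ : ℝ) (a : ℕ → ℂ)
    (h1 : a 1 * a r ≠ 0)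
    (h0 : a 0 * a r ≠ Complex.exp (2 * θ * Complex.I) * star (a 0 * a r))
    (hcop : IsCoprime (PseudoRealMaps.numerator r a) (PseudoRealMaps.denominator r θ a))
    (ψ φ : RatFunc ℂ)
    (hψ : ψ = algebraMap (Polynomial ℂ) (RatFunc ℂ) (PseudoRealMaps.numerator r a) /
      algebraMap (Polynomial ℂ) (RatFunc ℂ) (PseudoRealMaps.denominator r θ a))
    (hφ : φ = RatFunc.X * RatFunc.eval RatFunc.C (RatFunc.X ^ n) ψ) :
    PseudoRealMaps.IsPseudoReal φ ∧
    PseudoRealMaps.Aut φ = Subgroup.zpowers (PseudoRealMaps.rotation n) ∧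
    Nonempty (PseudoRealMaps.Aut φ ≃* Multiplicative (ZMod n)) := by
  have hn0 : n ≠ 0 := by lia
  have ha1 : a 1 ≠ 0 := left_ne_zero_of_mul h1
  have har : a r ≠ 0 := right_ne_zero_of_mul h1
  have ha0 : a 0 ≠ 0 := fun h => h0 (by simp [h])
  have h : PseudoRealMaps.IsTwisted n r a (PseudoRealMaps.dualCoeff r θ a) φ :=
    { n_ne_zero := hn0
      lead_ne_zero := har
      const_ne_zero := by simpa [PseudoRealMaps.dualCoeff] using har
      isCoprime := hcop
      eq := by rw [hφ, hψ, PseudoRealMaps.denominator_eq] }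
  have hne : a 0 * a r ≠
      PseudoRealMaps.dualCoeff r θ a 0 * PseudoRealMaps.dualCoeff r θ a r := by
    convert h0 using 1
    have hexp : Complex.exp (2 * θ * Complex.I) =
        Complex.exp (θ * Complex.I) * Complex.exp (θ * Complex.I) := by
      rw [← Complex.exp_add]
      ring_nf
    simp only [PseudoRealMaps.dualCoeff, hr_even.neg_one_pow, pow_zero, Nat.sub_zero, Nat.sub_self,
      hexp, star_mul']
    ring
  have hAut := h.Aut_eq hn (by lia) ha0 ha1 hne
  obtain ⟨c, hc, hcn⟩ := PseudoRealMaps.exists_pow_eq_neg_one hn0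
  have hQ := h.isAntiholomorphicAut hr_even hc hcn
  refine ⟨⟨⟨_, hQ⟩, PseudoRealMaps.not_isReal_of_isAntiholomorphicAut hn0 hAut hc hcn hQ⟩, hAut, ?_⟩
  have e := zmodCyclicMulEquiv (G := Subgroup.zpowers (PseudoRealMaps.rotation n)) inferInstance
  rw [Nat.card_zpowers, PseudoRealMaps.orderOf_rotation hn0] at e
  rw [hAut]
  exact ⟨e.symm⟩
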